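/- Let $R=\mathbb{C}[x_0,x_1,x_2,x_3]$. For positive integers $a\le b\le c$, a $CI(a,b,c)$ (a complete intersection zero-dimensional scheme of type $(a,b,c)$) is a closed subscheme $\mathbb{X}\subset\mathbb{P}^3_{\mathbb{C}}$ whose homogeneous ideal is $I_{\mathbb{X}}=(F,G,H)$, where $F,G,H\in R$ are forms of degrees $a,b,c$ that are a regular sequence in $R$. A surface $M=0$, with $M\in R$ a nonzero form of degree $d$, contains $\mathbb{X}$ if $M\in I_{\mathbb{X}}$. The generic surface of degree $d$ is said to have a property if all surfaces in some nonempty Zariski open subset of the projective space $\mathbb{P}(R_d)$ of surfaces of degree $d$ have it. Let $c$ and $d$ be integers. (1) If $c\ge 13$ and $d\ge 2c+15$, then the generic surface of degree $d$ in $\mathbb{P}^3$ contains no $CI(5,12,c)$. (2) If $c\ge 10$ and $d\ge 2c+12$, then the generic surface of degree $d$ in $\mathbb{P}^3$ contains no $CI(6,8,c)$. -/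

import Mathlib

namespace CIPoints

/-- The homogeneous coordinate ring `ℂ[x₀, x₁, x₂, x₃]` of complex projective 3-space. -/
abbrev R : Type := MvPolynomial (Fin 4) ℂ

/-- The indices of the coefficients of a quaternary form of degree `d`: the exponents of the
monomials of degree exactly `d`. -/
abbrev Exponent (d : ℕ) : Type := {m : Fin 4 →₀ ℕ // m.degree = d}

/-- The coefficient vector of a form of degree `d`, i.e. the (homogeneous) coordinates of the
surface `M = 0` in the projective space of degree `d` surfaces. -/
noncomputable def formCoeffs (d : ℕ) (M : R) : Exponent d → ℂ := fun m => MvPolynomial.coeff m.1 M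

/-- `I` is the homogeneous ideal `I_X` of a complete intersection zero-dimensional subscheme
`X` of projective 3-space of type `(a, b, c)`: it is generated by forms `F, G, H` of degrees
`a, b, c` that are a regular sequence. Such an ideal is saturated (for positive degrees), so it is
the full homogeneous ideal of the closed subscheme that it defines. -/
def IsCIIdeal (a b c : ℕ) (I : Ideal R) : Prop :=
  ∃ F G H : R, F.IsHomogeneous a ∧ G.IsHomogeneous b ∧ H.IsHomogeneous c ∧
    RingTheory.Sequence.IsRegular R [F, G, H] ∧ I = Ideal.span {F, G, H}

/-- The surface `M = 0` contains a complete intersection scheme of type `(a, b, c)`: the ideal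
`(M)` of the surface is contained in the homogeneous ideal of such a scheme. -/
def SurfaceContainsCI (M : R) (a b c : ℕ) : Prop :=
  ∃ I : Ideal R, IsCIIdeal a b c I ∧ Ideal.span {M} ≤ I

/-- The generic surface of degree `d` in projective 3-space has the property `P`: in the projective
space of surfaces of degree `d`, `P` holds on a nonempty Zariski open set; equivalently, on the
complement of the zero locus of a nonzero homogeneous polynomial `Φ` in the coefficients. -/
def GenericSurface (d : ℕ) (P : R → Prop) : Prop :=
  ∃ (k : ℕ) (Φ : MvPolynomial (Exponent d) ℂ), Φ.IsHomogeneous k ∧ Φ ≠ 0 ∧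
    ∀ M : R, M.IsHomogeneous d → M ≠ 0 → MvPolynomial.eval (formCoeffs d M) Φ ≠ 0 → P M

end CIPoints

/-! The proof is a dimension count. Triples of forms `F i` of degrees `e i` and cofactors `A i` of
degrees `d - e i` form an affine space, and the forms `∑ F i * A i` are its image under a quadratic
map to the forms of degree `d`. If the components `genCoeff` of this map are algebraically
dependent, any homogeneous relation among them vanishes on every surface containing a `CI(a,b,c)`,
so its complement is the required open set.

Dependence follows from vector fields tangent to the fibres
(`not_algebraicIndependent_of_derivation`). They come from changing generators, `F i + u * F j`, and
from Koszul syzygies among the cofactors. At the point `(x₀^a, x₁^b, x₂^c; 0, 0, 0)` they are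
independent, with one field for each `Redundant` coordinate. It remains to show that there are fewer
irredundant coordinates than monomials of degree `d`. The irredundant cofactor coordinates number at
most the monomials of degree `d` minus `a * b * c` (`card_irredundant_inr_add_prod_le`). So it
suffices that the irredundant coordinates of the generators number less than `a * b * c`, a
condition free of `d`. In both families this is checked at the smallest `c`; raising `c` by `k` adds
at most `a * b * k` to the left and exactly that to the right. -/

namespace CIPoints

open MvPolynomial

/-! ### Derivations and algebraic dependence -/

section Jacobian

/-- A derivation vanishing on a subalgebra `S` of a domain of characteristic zero vanishes on every
element that is algebraic over `S`. -/
theorem derivation_eq_zero_of_isAlgebraic {k A : Type*} [Field k] [CharZero k] [CommRing A]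
    [IsDomain A] [Algebra k A] (S : Subalgebra k A) (D : Derivation k A A)
    (hD : ∀ s ∈ S, D s = 0) (x : A) (hx : IsAlgebraic S x) : D x = 0 := by
  let D' : Derivation S A A :=
    { toFun := D
      map_add' := D.map_add
      map_smul' := fun s y => by
        simp [Subalgebra.smul_def, hD s.1 s.2]
      map_one_eq_zero' := D.map_one_eq_zero
      leibniz' := D.leibniz }
  have : CharZero S := charZero_of_injective_algebraMap (FaithfulSMul.algebraMap_injective k S)
  have key : ∀ n : ℕ, ∀ q : Polynomial S, q ≠ 0 → q.natDegree = n → Polynomial.aeval x q = 0 →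
      D' x = 0 := by
    intro n
    induction n using Nat.strong_induction_on with
    | _ n ih =>
      intro q hq hn hqx
      -- This gives `q'(x) * D x = 0`: either `D x = 0`, or `x` is a root of `q'`, which is nonzero
      -- in characteristic zero and of smaller degree.
      have h := D'.map_aeval q x
      rw [hqx, map_zero, eq_comm, smul_eq_mul, mul_eq_zero] at h
      rcases h with h | h
      · have hn0 : q.natDegree ≠ 0 := by
          intro h0
          rw [Polynomial.eq_C_of_natDegree_eq_zero h0, Polynomial.aeval_C] at hqx
          have hc : q.coeff 0 = 0 := by
            simpa using hqx
          apply hq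
          rw [Polynomial.eq_C_of_natDegree_eq_zero h0, hc, map_zero]
        have hd : Polynomial.derivative q ≠ 0 := fun h0 =>
          hn0 (Polynomial.derivative_eq_zero.1 h0)
        exact ih _ (hn ▸ Polynomial.natDegree_derivative_lt hn0) _ hd rfl h
      · exact h
  obtain ⟨q, hq, hqx⟩ := hx
  exact key _ q hq rfl hqx

/-- Too many independent derivations that kill `f` force the family of polynomials `f` to be
algebraically dependent. -/
theorem not_algebraicIndependent_of_derivation {k : Type*} {σ ι τ : Type} [Field k] [CharZero k]
    [Fintype σ] [Fintype ι] [Fintype τ] [DecidableEq τ] (f : ι → MvPolynomial σ k) (t : τ → σ)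
    (W : τ → Derivation k (MvPolynomial σ k) (MvPolynomial σ k)) (hW : ∀ i j, W i (f j) = 0)
    (hdet : (Matrix.of fun i l => W i (X (t l))).det ≠ 0)
    (hcard : Fintype.card σ < Fintype.card ι + Fintype.card τ) :
    ¬ AlgebraicIndependent k f := by
  classical
  intro hf
  have hspan : Algebra.IsAlgebraic
      (Algebra.adjoin k (Set.range f ∪ Set.range (X : σ → MvPolynomial σ k)))
      (MvPolynomial σ k) := by
    have htop : Algebra.adjoin k (Set.range f ∪ Set.range (X : σ → MvPolynomial σ k)) = ⊤ :=
      top_unique (adjoin_range_X (σ := σ) (R := k) ▸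
        Algebra.adjoin_mono Set.subset_union_right)
    rw [htop]
    exact ⟨fun x => isAlgebraic_algebraMap (⟨x, trivial⟩ : (⊤ : Subalgebra k (MvPolynomial σ k)))⟩
  -- Completing `f` by variables to a transcendence basis `u` adds fewer than `card τ` elements.
  -- Some nontrivial combination of the `W i` therefore kills all of `u`, hence everything,
  -- contradicting `hdet`.
  obtain ⟨u, hsu, hut, hu⟩ := exists_isTranscendenceBasis_between (R := k) (Set.range f)
    (Set.range f ∪ Set.range X) Set.subset_union_left
    (algebraicIndependent_subtype_range hf.injective |>.2 hf)
  have hcu : Cardinal.lift (Cardinal.mk u) = Cardinal.lift (Cardinal.mk σ) :=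
    hu.lift_cardinalMk_eq (IsTranscendenceBasis.mvPolynomial σ k)
  have hfin : u.Finite := ((Set.finite_range f).union (Set.finite_range X)).subset hut
  have : Fintype u := hfin.fintype
  have hcu' : Fintype.card u = Fintype.card σ := by
    rw [Cardinal.mk_fintype, Cardinal.mk_fintype, Cardinal.lift_natCast,
      Cardinal.lift_natCast] at hcu
    exact_mod_cast hcu
  have hrest : Fintype.card ↥(u \ Set.range f) + Fintype.card ι = Fintype.card σ := by
    rw [← hcu', ← Set.card_range_of_injective hf.injective, ← Nat.card_eq_fintype_card,
      ← Nat.card_eq_fintype_card, ← Nat.card_eq_fintype_card, Nat.card_coe_set_eq,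
      Nat.card_coe_set_eq, Nat.card_coe_set_eq]
    exact Set.ncard_sdiff_add_ncard_of_subset hsu hfin
  let Λ : (τ → MvPolynomial σ k) →ₗ[MvPolynomial σ k] (↥(u \ Set.range f) → MvPolynomial σ k) :=
    { toFun := fun c y => ∑ i, c i * W i y.1
      map_add' := fun c c' => by
        ext1 y
        simp [add_mul, Finset.sum_add_distrib]
      map_smul' := fun r c => by
        ext1 y
        simp [Finset.mul_sum, mul_assoc] }
  have hΛ : ¬ Function.Injective Λ := fun h => by
    have := card_le_of_injective (MvPolynomial σ k) Λ h
    omega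
  obtain ⟨c, hc, hc0⟩ : ∃ c, Λ c = 0 ∧ c ≠ 0 := by
    by_contra! h
    exact hΛ ((injective_iff_map_eq_zero Λ).2 h)
  let D : Derivation k (MvPolynomial σ k) (MvPolynomial σ k) := ∑ i, c i • W i
  have hDapp : ∀ y, D y = ∑ i, c i * W i y := fun y => by
    have h := congrFun (map_sum (Derivation.coeFnAddMonoidHom (R := k) (A := MvPolynomial σ k)
      (M := MvPolynomial σ k)) (fun i => c i • W i) Finset.univ) y
    simpa only [Finset.sum_apply, Derivation.coeFnAddMonoidHom_apply, Derivation.smul_apply,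
      smul_eq_mul] using h
  have hDu : ∀ y ∈ u, D y = 0 := by
    intro y hy
    rw [hDapp]
    by_cases hyf : y ∈ Set.range f
    · obtain ⟨j, rfl⟩ := hyf
      simp [hW]
    · exact congrFun hc ⟨y, hy, hyf⟩
  have hDS : ∀ s ∈ Algebra.adjoin k u, D s = 0 := fun s hs =>
    D.eqOn_adjoin (D2 := 0) (fun y hy => by simpa using hDu y hy) hs
  have hualg := hu.isAlgebraic
  rw [Subtype.range_coe] at hualg
  have hD : ∀ x, D x = 0 := fun x =>
    derivation_eq_zero_of_isAlgebraic _ D hDS x (hualg.isAlgebraic x)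
  apply hc0
  apply Matrix.eq_zero_of_vecMul_eq_zero hdet
  ext1 l
  simpa [Matrix.vecMul, dotProduct] using (hDapp (X (t l))).symm.trans (hD _)

end Jacobian

/-! ### The parameter space and its fibre-tangent vector fields -/

section Parametrization

instance finite_exponent (d : ℕ) : Finite (Exponent d) := by
  refine Finite.of_injective
    (fun (m : Exponent d) (i : Fin 4) => (⟨m.1 i, ?_⟩ : Fin (d + 1))) ?_
  · have h := Finsupp.le_degree i m.1
    have := m.2
    omega
  · intro m m' h
    ext i
    simpa using congrFun h i

noncomputable instance fintype_exponent (d : ℕ) : Fintype (Exponent d) := Fintype.ofFinite _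

/-- The form of degree `n` with prescribed coefficients. -/
noncomputable def formOfCoeffs {A : Type*} [CommRing A] (n : ℕ) (c : Exponent n → A) :
    MvPolynomial (Fin 4) A :=
  ∑ m : Exponent n, monomial m.1 (c m)

section

variable {A : Type*} [CommRing A]

theorem coeff_formOfCoeffs {n : ℕ} (c : Exponent n → A) (m : Exponent n) :
    coeff m.1 (formOfCoeffs n c) = c m := by
  classical
  rw [formOfCoeffs, coeff_sum, Finset.sum_eq_single m]
  · simp
  · intro b _ hb
    rw [coeff_monomial, if_neg (fun h => hb (Subtype.ext h))]
  · simp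

theorem isHomogeneous_formOfCoeffs {n : ℕ} (c : Exponent n → A) :
    (formOfCoeffs n c).IsHomogeneous n :=
  IsHomogeneous.sum _ _ _ fun m _ => isHomogeneous_monomial _ m.2

theorem formOfCoeffs_coeff {n : ℕ} {P : MvPolynomial (Fin 4) A} (hP : P.IsHomogeneous n) :
    formOfCoeffs n (fun m => coeff m.1 P) = P := by
  ext m
  by_cases hm : m.degree = n
  · exact coeff_formOfCoeffs (fun m : Exponent n => coeff m.1 P) ⟨m, hm⟩
  · rw [(isHomogeneous_formOfCoeffs _).coeff_eq_zero hm, hP.coeff_eq_zero hm]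

theorem map_formOfCoeffs {B : Type*} [CommRing B] (φ : A →+* B) {n : ℕ} (c : Exponent n → A) :
    map φ (formOfCoeffs n c) = formOfCoeffs n (fun m => φ (c m)) := by
  simp [formOfCoeffs, map_monomial]

end

/-- Coordinates on the space of triples of forms of degrees `e i` together with triples of
cofactors of degrees `d - e i`. -/
abbrev Param (e : Fin 3 → ℕ) (d : ℕ) : Type :=
  (Σ i, Exponent (e i)) ⊕ (Σ i, Exponent (d - e i))

variable (e : Fin 3 → ℕ) (d : ℕ)

/-- The generic form of degree `e i`. -/
noncomputable def genForm (i : Fin 3) : MvPolynomial (Fin 4) (MvPolynomial (Param e d) ℂ) :=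
  formOfCoeffs (e i) fun m => X (Sum.inl ⟨i, m⟩)

/-- The generic cofactor of degree `d - e i`. -/
noncomputable def genCofactor (i : Fin 3) : MvPolynomial (Fin 4) (MvPolynomial (Param e d) ℂ) :=
  formOfCoeffs (d - e i) fun m => X (Sum.inr ⟨i, m⟩)

/-- The coefficients of the generic combination of generic forms. -/
noncomputable def genCoeff (m : Exponent d) : MvPolynomial (Param e d) ℂ :=
  coeff m.1 (∑ i, genForm e d i * genCofactor e d i)

variable {e d}

theorem derivation_coeff_mul {B : Type*} [CommRing B] [Algebra ℂ B] (W : Derivation ℂ B B)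
    {P Q P' Q' : MvPolynomial (Fin 4) B} (hP : ∀ m, W (coeff m P) = coeff m P')
    (hQ : ∀ m, W (coeff m Q) = coeff m Q') (m : Fin 4 →₀ ℕ) :
    W (coeff m (P * Q)) = coeff m (P' * Q + P * Q') := by
  classical
  simp only [coeff_add, coeff_mul, map_sum, Derivation.leibniz, smul_eq_mul, hP, hQ,
    Finset.sum_add_distrib]
  rw [add_comm]
  congr 1
  exact Finset.sum_congr rfl fun _ _ => mul_comm _ _

/-- The derivation of the coordinate ring of the parameter space that is given by a tangent
vector field. -/
noncomputable def tangentDerivation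
    (δF δA : Fin 3 → MvPolynomial (Fin 4) (MvPolynomial (Param e d) ℂ)) :
    Derivation ℂ (MvPolynomial (Param e d) ℂ) (MvPolynomial (Param e d) ℂ) :=
  mkDerivation ℂ (Sum.elim (fun s => coeff s.2.1 (δF s.1)) (fun s => coeff s.2.1 (δA s.1)))

theorem tangentDerivation_genCoeff
    {δF δA : Fin 3 → MvPolynomial (Fin 4) (MvPolynomial (Param e d) ℂ)}
    (hF : ∀ i, (δF i).IsHomogeneous (e i)) (hA : ∀ i, (δA i).IsHomogeneous (d - e i))
    (h : ∑ i, (δF i * genCofactor e d i + genForm e d i * δA i) = 0) (m : Exponent d) :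
    tangentDerivation δF δA (genCoeff e d m) = 0 := by
  have h1 : ∀ i μ, tangentDerivation δF δA (coeff μ (genForm e d i)) = coeff μ (δF i) := by
    intro i μ
    by_cases hμ : μ.degree = e i
    · rw [genForm, coeff_formOfCoeffs _ ⟨μ, hμ⟩, tangentDerivation, mkDerivation_X, Sum.elim_inl]
    · rw [genForm, (isHomogeneous_formOfCoeffs _).coeff_eq_zero hμ, (hF i).coeff_eq_zero hμ,
        map_zero]
  have h2 : ∀ i μ, tangentDerivation δF δA (coeff μ (genCofactor e d i)) = coeff μ (δA i) := by
    intro i μ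
    by_cases hμ : μ.degree = d - e i
    · rw [genCofactor, coeff_formOfCoeffs _ ⟨μ, hμ⟩, tangentDerivation, mkDerivation_X,
        Sum.elim_inr]
    · rw [genCofactor, (isHomogeneous_formOfCoeffs _).coeff_eq_zero hμ, (hA i).coeff_eq_zero hμ,
        map_zero]
  rw [genCoeff, coeff_sum, map_sum,
    Finset.sum_congr rfl fun i _ => derivation_coeff_mul _ (h1 i) (h2 i) m.1, ← coeff_sum, h,
    coeff_zero]

variable (e d) in
/-- The parameter point `(x₀ ^ e₀, x₁ ^ e₁, x₂ ^ e₂; 0, 0, 0)`. -/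
noncomputable def basePoint : Param e d → ℂ :=
  Sum.elim (fun s => coeff s.2.1 (monomial (Finsupp.single s.1.castSucc (e s.1)) (1 : ℂ)))
    fun _ => 0

theorem map_basePoint_genForm (i : Fin 3) :
    map (eval (basePoint e d)) (genForm e d i) =
      monomial (Finsupp.single i.castSucc (e i)) (1 : ℂ) := by
  rw [genForm, map_formOfCoeffs]
  simp only [eval_X, basePoint, Sum.elim_inl]
  exact formOfCoeffs_coeff (isHomogeneous_monomial _ (by simp))

theorem map_basePoint_genCofactor (i : Fin 3) :
    map (eval (basePoint e d)) (genCofactor e d i) = 0 := by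
  rw [genCofactor, map_formOfCoeffs]
  simp [eval_X, basePoint, formOfCoeffs]

/-- The coordinates that are redundant at the base point, because of a Koszul relation. -/
def Redundant : Param e d → Prop :=
  Sum.elim (fun s => ∃ j ≤ s.1, e j ≤ s.2.1 j.castSucc)
    (fun s => ∃ j < s.1, e j ≤ s.2.1 j.castSucc)

/-- Write `m = x_j^(e j) * u`. Moving `F i` along `u * F j` and `A j` along `-u * A i` preserves `∑
F i * A i`. At the base point the cofactors vanish, so only the coordinate `m` of `F i` moves. -/
theorem exists_derivation_inl (i : Fin 3) (m : Exponent (e i)) (hd : e i ≤ d)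
    (h : ∃ j ≤ i, e j ≤ m.1 j.castSucc) :
    ∃ W : Derivation ℂ (MvPolynomial (Param e d) ℂ) (MvPolynomial (Param e d) ℂ),
      (∀ μ, W (genCoeff e d μ) = 0) ∧ ∀ t,
        eval (basePoint e d) (W (X t)) = if Sum.inl ⟨i, m⟩ = t then 1 else 0 := by
  classical
  obtain ⟨j, -, hj⟩ := h
  have hle : Finsupp.single j.castSucc (e j) ≤ m.1 := by
    simpa [Finsupp.single_le_iff] using hj
  obtain ⟨u, hu⟩ := exists_add_of_le hle
  have hdeg : e j + u.degree = e i := by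
    rw [← m.2, hu]
    simp
  refine ⟨tangentDerivation (Pi.single i (genForm e d j * monomial u 1))
    (Pi.single j (-(genCofactor e d i * monomial u 1))), tangentDerivation_genCoeff ?_ ?_ ?_, ?_⟩
  · intro k
    obtain rfl | hk := eq_or_ne k i
    · rw [Pi.single_eq_same, ← hdeg]
      exact (isHomogeneous_formOfCoeffs _).mul (isHomogeneous_monomial _ rfl)
    · rw [Pi.single_eq_of_ne hk]
      exact isHomogeneous_zero _ _ _
  · intro k
    obtain rfl | hk := eq_or_ne k j
    · rw [Pi.single_eq_same, show d - e k = d - e i + u.degree by omega]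
      exact ((isHomogeneous_formOfCoeffs _).mul (isHomogeneous_monomial _ rfl)).neg
    · rw [Pi.single_eq_of_ne hk]
      exact isHomogeneous_zero _ _ _
  · rw [Finset.sum_add_distrib, Finset.sum_eq_single i, Finset.sum_eq_single j]
    · rw [Pi.single_eq_same, Pi.single_eq_same]
      ring
    · intro k _ hk
      rw [Pi.single_eq_of_ne hk, mul_zero]
    · simp
    · intro k _ hk
      rw [Pi.single_eq_of_ne hk, zero_mul]
    · simp
  · rintro (⟨k, μ⟩ | ⟨k, μ⟩)
    · rw [tangentDerivation, mkDerivation_X, Sum.elim_inl, ← coeff_map]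
      obtain rfl | hk := eq_or_ne k i
      · rw [Pi.single_eq_same, map_mul, map_basePoint_genForm, map_monomial, (eval (basePoint e d)).map_one,
          monomial_mul, one_mul, ← hu, coeff_monomial]
        simp [Subtype.ext_iff]
      · rw [Pi.single_eq_of_ne hk, map_zero, coeff_zero, if_neg]
        intro h
        simp only [Sum.inl.injEq, Sigma.mk.injEq] at h
        exact hk h.1.symm
    · rw [tangentDerivation, mkDerivation_X, Sum.elim_inr, ← coeff_map, if_neg (by simp)]
      obtain rfl | hk := eq_or_ne k j
      · rw [Pi.single_eq_same, map_neg, map_mul, map_basePoint_genCofactor, zero_mul, neg_zero,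
          coeff_zero]
      · rw [Pi.single_eq_of_ne hk, map_zero, coeff_zero]

/-- The field is the Koszul syzygy moving `A i` along `u * F j` and `A j` along `-u * F i`. At the
base point it also moves a coordinate of `A j`; choosing `j` minimal makes that coordinate
irredundant, so the matrix on redundant coordinates is still the identity. -/
theorem exists_derivation_inr (i : Fin 3) (m : Exponent (d - e i)) (hd : e i ≤ d)
    (h : ∃ j < i, e j ≤ m.1 j.castSucc) :
    ∃ W : Derivation ℂ (MvPolynomial (Param e d) ℂ) (MvPolynomial (Param e d) ℂ),
      (∀ μ, W (genCoeff e d μ) = 0) ∧ ∀ t, Redundant t →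
        eval (basePoint e d) (W (X t)) = if Sum.inr ⟨i, m⟩ = t then 1 else 0 := by
  classical
  obtain ⟨j, ⟨hji, hj⟩, hmin⟩ := WellFounded.has_min (wellFounded_lt (α := Fin 3))
    {j | j < i ∧ e j ≤ m.1 j.castSucc} h
  have hle : Finsupp.single j.castSucc (e j) ≤ m.1 := by
    simpa [Finsupp.single_le_iff] using hj
  obtain ⟨u, hu⟩ := exists_add_of_le hle
  have hdeg : e j + u.degree = d - e i := by
    rw [← m.2, hu]
    simp
  refine ⟨tangentDerivation 0 (Pi.single i (genForm e d j * monomial u 1) +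
    Pi.single j (-(genForm e d i * monomial u 1))), tangentDerivation_genCoeff ?_ ?_ ?_, ?_⟩
  · exact fun _ => isHomogeneous_zero _ _ _
  · intro k
    refine IsHomogeneous.add ?_ ?_
    · obtain rfl | hk := eq_or_ne k i
      · rw [Pi.single_eq_same, ← hdeg]
        exact (isHomogeneous_formOfCoeffs _).mul (isHomogeneous_monomial _ rfl)
      · rw [Pi.single_eq_of_ne hk]
        exact isHomogeneous_zero _ _ _
    · obtain rfl | hk := eq_or_ne k j
      · rw [Pi.single_eq_same, show d - e k = e i + u.degree by omega]
        exact ((isHomogeneous_formOfCoeffs _).mul (isHomogeneous_monomial _ rfl)).neg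
      · rw [Pi.single_eq_of_ne hk]
        exact isHomogeneous_zero _ _ _
  · simp only [Pi.zero_apply, zero_mul, zero_add, Pi.add_apply, mul_add]
    rw [Finset.sum_add_distrib, Finset.sum_eq_single i, Finset.sum_eq_single j]
    · rw [Pi.single_eq_same, Pi.single_eq_same]
      ring
    · intro k _ hk
      rw [Pi.single_eq_of_ne hk, mul_zero]
    · simp
    · intro k _ hk
      rw [Pi.single_eq_of_ne hk, mul_zero]
    · simp
  · rintro (⟨k, μ⟩ | ⟨k, μ⟩) ht
    · rw [tangentDerivation, mkDerivation_X, Sum.elim_inl]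
      simp
    · rw [tangentDerivation, mkDerivation_X, Sum.elim_inr, ← coeff_map, Pi.add_apply]
      obtain rfl | hk := eq_or_ne k i
      · rw [Pi.single_eq_same, Pi.single_eq_of_ne hji.ne', add_zero, map_mul,
          map_basePoint_genForm, map_monomial, (eval (basePoint e d)).map_one, monomial_mul, one_mul, ← hu,
          coeff_monomial]
        simp [Subtype.ext_iff]
      · rw [if_neg (fun h => hk (by
          simp only [Sum.inr.injEq, Sigma.mk.injEq] at h
          exact h.1.symm)), Pi.single_eq_of_ne hk, zero_add]
        obtain rfl | hkj := eq_or_ne k j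
        · rw [Pi.single_eq_same, map_neg, map_mul, map_basePoint_genForm, map_monomial, (eval (basePoint e d)).map_one,
            monomial_mul, one_mul, coeff_neg, coeff_monomial, if_neg, neg_zero]
          intro hμ
          obtain ⟨l, hl, hel⟩ := ht
          dsimp only at hl hel
          -- If `x_l^(e l)` with `l < j` divides `u * x_i^(e i)`, it divides `u` since `l ≠ i`,
          -- hence divides `m`, against the minimality of `j`.
          refine hmin l ⟨hl.trans hji, ?_⟩ hl
          have h1 : (Fin.castSucc i) ≠ l.castSucc := fun h =>
            (hl.trans hji).ne' (Fin.castSucc_injective _ h)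
          rw [← hμ, Finsupp.add_apply, Finsupp.single_apply, if_neg h1, zero_add] at hel
          rw [hu, Finsupp.add_apply]
          omega
        · rw [Pi.single_eq_of_ne hkj, map_zero, coeff_zero]

/-- If the number of irredundant parameters is less than the number of coefficients of a form of
degree `d`, then the forms in an ideal generated by forms of degrees `e i` satisfy a universal
polynomial relation. -/
theorem not_algebraicIndependent_genCoeff (hd : ∀ i, e i ≤ d)
    (hcard : Nat.card {t : Param e d // ¬ Redundant t} < Nat.card (Exponent d)) :
    ¬ AlgebraicIndependent ℂ (genCoeff e d) := by
  classical
  have key : ∀ s : {t : Param e d // Redundant t},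
      ∃ W : Derivation ℂ (MvPolynomial (Param e d) ℂ) (MvPolynomial (Param e d) ℂ),
      (∀ μ, W (genCoeff e d μ) = 0) ∧ ∀ t, Redundant t →
        eval (basePoint e d) (W (X t)) = if s.1 = t then 1 else 0 := by
    rintro ⟨⟨i, m⟩ | ⟨i, m⟩, hs⟩
    · obtain ⟨W, hW, hW'⟩ := exists_derivation_inl i m (hd i) hs
      exact ⟨W, hW, fun t _ => hW' t⟩
    · exact exists_derivation_inr i m (hd i) hs
  choose W hW hW' using key
  refine not_algebraicIndependent_of_derivation (genCoeff e d) Subtype.val W hW ?_ ?_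
  · intro h
    have h1 := congrArg (eval (basePoint e d)) h
    rw [RingHom.map_det, map_zero] at h1
    refine one_ne_zero (α := ℂ) (Eq.trans ?_ h1)
    rw [← Matrix.det_one (n := {t : Param e d // Redundant t})]
    congr 1
    ext s t
    simp [hW' s t.1 t.2, Matrix.one_apply, Subtype.ext_iff]
  · rw [Nat.card_eq_fintype_card, Nat.card_eq_fintype_card] at hcard
    have := Fintype.card_subtype_compl (fun t : Param e d => Redundant t)
    have := Fintype.card_subtype_le (fun t : Param e d => Redundant t)
    omega

end Parametrization

/-! ### From a polynomial relation to a generic property -/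

section Relation

theorem homogeneousComponent_mul_of_isHomogeneous {a d : ℕ} (had : a ≤ d) {F : R}
    (hF : F.IsHomogeneous a) (P : R) :
    homogeneousComponent d (F * P) = F * homogeneousComponent (d - a) P := by
  conv_lhs => rw [← sum_homogeneousComponent P, Finset.mul_sum, map_sum]
  have h : ∀ j, homogeneousComponent d (F * homogeneousComponent j P) =
      if j = d - a then F * homogeneousComponent (d - a) P else 0 := by
    intro j
    rw [homogeneousComponent_of_mem (hF.mul (homogeneousComponent_isHomogeneous j P))]
    by_cases hj : j = d - a
    · rw [if_pos hj, if_pos (by omega), hj]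
    · rw [if_neg hj, if_neg (by omega)]
  simp only [h]
  rw [Finset.sum_ite_eq', ite_eq_left_iff]
  intro hj
  rw [Finset.mem_range, not_lt] at hj
  rw [homogeneousComponent_eq_zero _ _ (by omega), mul_zero]

theorem isHomogeneous_genCoeff {e : Fin 3 → ℕ} {d : ℕ} (m : Exponent d) :
    (genCoeff e d m).IsHomogeneous 2 := by
  have h : ∀ (n : ℕ) (v : Exponent n → Param e d) (μ : Fin 4 →₀ ℕ),
      (coeff μ (formOfCoeffs n fun m => (X (v m) : MvPolynomial (Param e d) ℂ))).IsHomogeneous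
        1 := by
    intro n v μ
    by_cases hμ : μ.degree = n
    · rw [coeff_formOfCoeffs _ ⟨μ, hμ⟩]
      exact isHomogeneous_X _ _
    · rw [(isHomogeneous_formOfCoeffs _).coeff_eq_zero hμ]
      exact isHomogeneous_zero _ _ _
  rw [genCoeff, coeff_sum]
  refine IsHomogeneous.sum _ _ _ fun i _ => ?_
  rw [coeff_mul]
  exact IsHomogeneous.sum _ _ _ fun μ _ => (h _ _ _).mul (h _ _ _)

/-- Since all `f i` have the same positive degree, the homogeneous components of a relation are sent
to distinct degrees and so vanish separately. -/
theorem exists_isHomogeneous_relation {σ ι : Type} {n : ℕ} (hn : n ≠ 0)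
    {f : ι → MvPolynomial σ ℂ} (hf : ∀ i, (f i).IsHomogeneous n)
    (h : ¬ AlgebraicIndependent ℂ f) :
    ∃ (k : ℕ) (Φ : MvPolynomial ι ℂ), Φ.IsHomogeneous k ∧ Φ ≠ 0 ∧ aeval f Φ = 0 := by
  rw [algebraicIndependent_iff] at h
  push Not at h
  obtain ⟨Φ, hΦ, hΦ0⟩ := h
  obtain ⟨k, hk⟩ : ∃ k, homogeneousComponent k Φ ≠ 0 := by
    by_contra! hall
    exact hΦ0 (by rw [← sum_homogeneousComponent Φ, Finset.sum_eq_zero fun i _ => hall i])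
  refine ⟨k, _, homogeneousComponent_isHomogeneous k Φ, hk, ?_⟩
  have h1 : ∀ j, homogeneousComponent (n * k) (aeval f (homogeneousComponent j Φ)) =
      if j = k then aeval f (homogeneousComponent k Φ) else 0 := by
    intro j
    rw [homogeneousComponent_of_mem ((homogeneousComponent_isHomogeneous j Φ).aeval f hf)]
    by_cases hj : j = k
    · rw [if_pos hj, if_pos (by rw [hj]), hj]
    · rw [if_neg hj, if_neg fun h => hj (Nat.eq_of_mul_eq_mul_left (Nat.pos_of_ne_zero hn) h.symm)]
  have h2 := congrArg (homogeneousComponent (n * k)) hΦ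
  rw [← sum_homogeneousComponent Φ, map_sum, map_sum, map_zero] at h2
  simp only [h1] at h2
  rw [Finset.sum_ite_eq'] at h2
  split_ifs at h2 with hmem
  · exact h2
  · rw [homogeneousComponent_eq_zero _ _ (by simpa using hmem), map_zero]

theorem genericSurface_not_surfaceContainsCI {a b c d : ℕ} (ha : a ≤ d) (hb : b ≤ d)
    (hc : c ≤ d) (h : ¬ AlgebraicIndependent ℂ (genCoeff ![a, b, c] d)) :
    GenericSurface d fun M => ¬ SurfaceContainsCI M a b c := by
  obtain ⟨k, Φ, hΦ, hΦ0, hrel⟩ := exists_isHomogeneous_relation two_ne_zero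
    isHomogeneous_genCoeff h
  refine ⟨k, Φ, hΦ, hΦ0, ?_⟩
  rintro M hM - hMΦ ⟨_, ⟨F, G, H, hF, hG, hH, -, rfl⟩, hI⟩
  rw [Ideal.span_singleton_le_iff_mem, Ideal.span, Submodule.mem_span_triple] at hI
  obtain ⟨p, q, r, hpqr⟩ := hI
  simp only [smul_eq_mul] at hpqr
  apply hMΦ
  let P : Fin 3 → R := ![F, G, H]
  let Q : Fin 3 → R := ![homogeneousComponent (d - a) p, homogeneousComponent (d - b) q,
    homogeneousComponent (d - c) r]
  have hP : ∀ i, (P i).IsHomogeneous (![a, b, c] i) := by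
    intro i
    fin_cases i
    exacts [hF, hG, hH]
  have hQ : ∀ i, (Q i).IsHomogeneous (d - ![a, b, c] i) := by
    intro i
    fin_cases i
    exacts [homogeneousComponent_isHomogeneous _ _, homogeneousComponent_isHomogeneous _ _,
      homogeneousComponent_isHomogeneous _ _]
  have hsum : ∑ i, P i * Q i = M := by
    rw [← homogeneousComponent_eq_self hM, ← hpqr, mul_comm p, mul_comm q, mul_comm r, map_add,
      map_add, homogeneousComponent_mul_of_isHomogeneous ha hF,
      homogeneousComponent_mul_of_isHomogeneous hb hG,
      homogeneousComponent_mul_of_isHomogeneous hc hH, Fin.sum_univ_three]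
    rfl
  let v : Param ![a, b, c] d → ℂ :=
    Sum.elim (fun s => coeff s.2.1 (P s.1)) (fun s => coeff s.2.1 (Q s.1))
  have hv : formCoeffs d M = fun m => eval v (genCoeff ![a, b, c] d m) := by
    funext m
    rw [genCoeff, ← coeff_map, map_sum, formCoeffs, ← hsum]
    congr 1
    refine Finset.sum_congr rfl fun i _ => ?_
    rw [map_mul, genForm, genCofactor, map_formOfCoeffs, map_formOfCoeffs]
    simp only [eval_X, v, Sum.elim_inl, Sum.elim_inr]
    rw [formOfCoeffs_coeff (hP i), formOfCoeffs_coeff (hQ i)]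
  have h1 := congrArg (eval v) hrel
  rw [map_zero, aeval_def, ← coe_eval₂Hom, ← RingHom.comp_apply] at h1
  rw [hv, ← h1]
  congr 1
  ext x <;> simp

end Relation

/-! ### Counting irredundant coordinates -/

section Counting

/-- A monomial of degree `d` divisible by some `x_i^(e i)` determines the least such `i` and an
irredundant cofactor monomial. The other monomials form a box of `∏ e i` exponent triples, padded by
`x₃`; `hd` says the largest triple sum, `∑ (e i - 1)`, is at most `d`. -/
theorem card_irredundant_inr_add_prod_le {e : Fin 3 → ℕ} {d : ℕ} (he : ∀ i, e i ≤ d)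
    (hd : ∑ i, e i ≤ d + 3) :
    Nat.card {s : Σ i, Exponent (d - e i) // ¬ Redundant (Sum.inr s : Param e d)} + ∏ i, e i ≤
      Nat.card (Exponent d) := by
  have hbox : ∏ i, e i = Nat.card (∀ i, Fin (e i)) := by
    simp
  have hdeg : ∀ x : ∀ i, Fin (e i), ∑ i, (x i : ℕ) ≤ d := by
    intro x
    have h0 := (x 0).2
    have h1 := (x 1).2
    have h2 := (x 2).2
    rw [Fin.sum_univ_three] at hd ⊢
    omega
  rw [hbox, ← Nat.card_sum]
  let g : {s : Σ i, Exponent (d - e i) // ¬ Redundant (Sum.inr s : Param e d)} ⊕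
      (∀ i, Fin (e i)) → Exponent d := Sum.elim
    (fun s => ⟨s.1.2.1 + Finsupp.single s.1.1.castSucc (e s.1.1), by
      have := he s.1.1
      rw [map_add, s.1.2.2, Finsupp.degree_single]
      omega⟩)
    (fun x => ⟨Finsupp.equivFunOnFinite.symm
      (Fin.snoc (α := fun _ => ℕ) (fun i => (x i : ℕ)) (d - ∑ i, (x i : ℕ))), by
      have := hdeg x
      rw [Finsupp.degree_eq_sum, Fin.sum_univ_castSucc]
      simp only [Finsupp.equivFunOnFinite_symm_apply_apply, Fin.snoc_castSucc, Fin.snoc_last]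
      omega⟩)
  have hlt : ∀ s : {s : Σ i, Exponent (d - e i) // ¬ Redundant (Sum.inr s : Param e d)},
      ∀ j < s.1.1, (g (Sum.inl s)).1 j.castSucc < e j := by
    intro s j hj
    have h := s.2
    simp only [Redundant, Sum.elim_inr, not_exists, not_and, not_le] at h
    have hne : s.1.1.castSucc ≠ j.castSucc := fun h => hj.ne' (Fin.castSucc_injective _ h)
    simpa [g, Finsupp.single_apply, hne] using h j hj
  have hge : ∀ s : {s : Σ i, Exponent (d - e i) // ¬ Redundant (Sum.inr s : Param e d)},
      e s.1.1 ≤ (g (Sum.inl s)).1 s.1.1.castSucc := by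
    intro s
    simp [g]
  have hboxlt : ∀ (x : ∀ i, Fin (e i)) (i : Fin 3), (g (Sum.inr x)).1 i.castSucc = x i := by
    intro x i
    simp [g]
  refine Nat.card_le_card_of_injective g ?_
  rintro (s | x) (s' | x') h
  · have hi : s.1.1 = s'.1.1 := by
      rcases lt_trichotomy s.1.1 s'.1.1 with hi | hi | hi
      · have h1 := hlt s' _ hi
        have h2 := hge s
        rw [h] at h2
        omega
      · exact hi
      · have h1 := hlt s _ hi
        have h2 := hge s'
        rw [← h] at h2
        omega
    obtain ⟨⟨i, m⟩, hs⟩ := s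
    obtain ⟨⟨i', m'⟩, hs'⟩ := s'
    obtain rfl : i = i' := hi
    simp only [g, Sum.elim_inl, Subtype.mk.injEq, add_left_inj] at h
    obtain rfl : m = m' := Subtype.ext h
    rfl
  · have h1 := hge s
    rw [h, hboxlt] at h1
    exact absurd (x' _).2 h1.not_gt
  · have h1 := hge s'
    rw [← h, hboxlt] at h1
    exact absurd (x _).2 h1.not_gt
  · congr 1
    funext i
    apply Fin.ext
    rw [← hboxlt, h, hboxlt]

theorem card_exponent_subtype_le {n : ℕ} {P : Exponent n → Prop} (α β : ℕ) (g : ℕ → ℕ → ℕ)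
    (hP : ∀ m, P m → m.1 0 < α ∧ m.1 1 < β ∧ m.1 2 < g (m.1 0) (m.1 1)) :
    Nat.card {m // P m} ≤ ∑ x ∈ Finset.range α, ∑ y ∈ Finset.range β, g x y := by
  have hcard : ∑ x ∈ Finset.range α, ∑ y ∈ Finset.range β, g x y = Nat.card
      ((Finset.range α).sigma fun x => (Finset.range β).sigma fun y => Finset.range (g x y)) := by
    rw [Nat.card_eq_fintype_card, Fintype.card_coe]
    simp only [Finset.card_sigma, Finset.card_range]
  rw [hcard]
  refine Nat.card_le_card_of_injective (fun m => ⟨⟨m.1.1 0, m.1.1 1, m.1.1 2⟩, ?_⟩) ?_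
  · simpa using hP m.1 m.2
  · intro m m' h
    simp only [Subtype.mk.injEq, Sigma.mk.injEq, heq_eq_eq] at h
    obtain ⟨h0, h1, h2⟩ := h
    have hm := m.1.2
    have hm' := m'.1.2
    rw [Finsupp.degree_eq_sum, Fin.sum_univ_four] at hm hm'
    apply Subtype.ext
    apply Subtype.ext
    ext i
    fin_cases i
    · exact h0
    · exact h1
    · exact h2
    · change m.1.1 3 = m'.1.1 3
      omega

theorem card_irredundant_inl_le (a b c d : ℕ) :
    Nat.card {s : Σ i, Exponent (![a, b, c] i) //
        ¬ Redundant (Sum.inl s : Param ![a, b, c] d)} ≤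
      ∑ x ∈ Finset.range a, ∑ y ∈ Finset.range (a + 1), (a + 1 - x - y) +
      ∑ x ∈ Finset.range a, ∑ y ∈ Finset.range b, (b + 1 - x - y) +
      ∑ x ∈ Finset.range a, ∑ y ∈ Finset.range b,
        (if x = 0 ∧ y = 0 then c else c + 1 - x - y) := by
  have h : Nat.card {s : Σ i, Exponent (![a, b, c] i) //
        ¬ Redundant (Sum.inl s : Param ![a, b, c] d)} ≤
      Nat.card (Σ i, {m : Exponent (![a, b, c] i) //
        ¬ Redundant (Sum.inl ⟨i, m⟩ : Param ![a, b, c] d)}) := by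
    refine Nat.card_le_card_of_injective (fun s => ⟨s.1.1, s.1.2, s.2⟩) ?_
    rintro ⟨⟨i, m⟩, hs⟩ ⟨⟨i', m'⟩, hs'⟩ h
    simp only [Sigma.mk.injEq] at h
    obtain ⟨rfl, h⟩ := h
    simpa using h
  refine h.trans ?_
  rw [Nat.card_sigma, Fin.sum_univ_three]
  have hdeg : ∀ {n : ℕ} (m : Exponent n), m.1 0 + m.1 1 + m.1 2 + m.1 3 = n := by
    intro n m
    rw [← Fin.sum_univ_four, ← Finsupp.degree_eq_sum, m.2]
  refine add_le_add (add_le_add ?_ ?_) ?_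
  · refine card_exponent_subtype_le _ _ (fun x y => a + 1 - x - y) fun m hm => ?_
    have h1 := hdeg m
    simp only [Redundant, Sum.elim_inl, not_exists, not_and, not_le] at hm
    have h0 : m.1 0 < a := hm 0 le_rfl
    change _ = a at h1
    omega
  · refine card_exponent_subtype_le _ _ (fun x y => b + 1 - x - y) fun m hm => ?_
    have h1 := hdeg m
    simp only [Redundant, Sum.elim_inl, not_exists, not_and, not_le] at hm
    have h0 : m.1 0 < a := hm 0 (by decide)
    have h2 : m.1 1 < b := hm 1 le_rfl
    change _ = b at h1
    omega
  -- At `x = y = 0` the exponent of `x₂` could be `c` by degree alone; the case split excludes the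
  -- redundant monomial `x₂^c`.
  · refine card_exponent_subtype_le _ _ (fun x y => if x = 0 ∧ y = 0 then c else c + 1 - x - y)
      fun m hm => ?_
    have h1 := hdeg m
    simp only [Redundant, Sum.elim_inl, not_exists, not_and, not_le] at hm
    have h0 : m.1 0 < a := hm 0 (by decide)
    have h2 : m.1 1 < b := hm 1 (by decide)
    have h3 : m.1 2 < c := hm 2 le_rfl
    change _ = c at h1
    refine ⟨h0, h2, ?_⟩
    split_ifs <;> omega

/-- A bound, uniform in `k`, for the number of monomials of degree `c + k` that are irredundant as
terms of the third generator. -/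
theorem sum_third_generator_le (a b c k : ℕ) :
    ∑ x ∈ Finset.range a, ∑ y ∈ Finset.range b,
        (if x = 0 ∧ y = 0 then c + k else c + k + 1 - x - y) ≤
      a * b * k + ∑ x ∈ Finset.range a, ∑ y ∈ Finset.range b,
        (if x = 0 ∧ y = 0 then c else c + 1 - x - y) := by
  have h : a * b * k = ∑ x ∈ Finset.range a, ∑ y ∈ Finset.range b, k := by
    simp [mul_assoc]
  rw [h, ← Finset.sum_add_distrib]
  refine Finset.sum_le_sum fun x _ => ?_
  rw [← Finset.sum_add_distrib]
  refine Finset.sum_le_sum fun y _ => ?_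
  split_ifs <;> omega

theorem genericSurface_of_sum_lt {a b c d : ℕ} (ha : a ≤ d) (hb : b ≤ d) (hc : c ≤ d)
    (hd : a + b + c ≤ d + 3)
    (h : ∑ x ∈ Finset.range a, ∑ y ∈ Finset.range (a + 1), (a + 1 - x - y) +
      ∑ x ∈ Finset.range a, ∑ y ∈ Finset.range b, (b + 1 - x - y) +
      ∑ x ∈ Finset.range a, ∑ y ∈ Finset.range b,
        (if x = 0 ∧ y = 0 then c else c + 1 - x - y) < a * b * c) :
    GenericSurface d fun M => ¬ SurfaceContainsCI M a b c := by
  have he : ∀ i, ![a, b, c] i ≤ d := by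
    intro i
    fin_cases i
    exacts [ha, hb, hc]
  refine genericSurface_not_surfaceContainsCI ha hb hc (not_algebraicIndependent_genCoeff he ?_)
  have h1 := card_irredundant_inr_add_prod_le he (by simpa [Fin.sum_univ_three] using hd)
  have h2 := card_irredundant_inl_le a b c d
  rw [show ∏ i, ![a, b, c] i = a * b * c by simp [Fin.prod_univ_three]] at h1
  rw [Nat.card_congr (Equiv.subtypeSum (p := fun t : Param ![a, b, c] d => ¬ Redundant t)),
    Nat.card_sum]
  refine lt_of_lt_of_le (Nat.add_lt_add_right (h2.trans_lt h) _) ?_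
  omega

end Counting

end CIPoints

theorem lemma5p4 :
    (∀ c d : ℕ, 13 ≤ c → 2 * c + 15 ≤ d →
      CIPoints.GenericSurface d (fun M => ¬ CIPoints.SurfaceContainsCI M 5 12 c)) ∧
    (∀ c d : ℕ, 10 ≤ c → 2 * c + 12 ≤ d →
      CIPoints.GenericSurface d (fun M => ¬ CIPoints.SurfaceContainsCI M 6 8 c)) := by
  constructor
  · intro c d hc hd
    obtain ⟨k, rfl⟩ := Nat.exists_eq_add_of_le hc
    refine CIPoints.genericSurface_of_sum_lt (by omega) (by omega) (by omega) (by omega) ?_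
    -- At `k = 0` the three sums are `55 + 334 + 390 = 779`, just below `5 * 12 * 13 = 780`.
    refine lt_of_le_of_lt (add_le_add le_rfl (CIPoints.sum_third_generator_le 5 12 13 k)) ?_
    simp only [Finset.sum_range_succ, Finset.sum_range_zero]
    norm_num
    omega
  · intro c d hc hd
    obtain ⟨k, rfl⟩ := Nat.exists_eq_add_of_le hc
    refine CIPoints.genericSurface_of_sum_lt (by omega) (by omega) (by omega) (by omega) ?_
    -- Here the sums are `83 + 154 + 240 = 477`, below `6 * 8 * 10 = 480`.
    refine lt_of_le_of_lt (add_le_add le_rfl (CIPoints.sum_third_generator_le 6 8 10 k)) ?_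
    simp only [Finset.sum_range_succ, Finset.sum_range_zero]
    norm_num
    omega
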